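/- Let $k$ be a field and let $A$, $U$ be finite-dimensional Hopf algebras over $k$ (with coproduct $\Delta(a)=a_{(1)}\otimes a_{(2)}$, counit $\epsilon$, antipode $S$) in duality through a nondegenerate bilinear pairing $\langle\cdot,\cdot\rangle:U\times A\to k$ that satisfies $\langle xy,a\rangle=\langle x,a_{(1)}\rangle\langle y,a_{(2)}\rangle$, $\langle x,ab\rangle=\langle x_{(1)},a\rangle\langle x_{(2)},b\rangle$, $\langle 1,a\rangle=\epsilon(a)$ and $\langle x,1\rangle=\epsilon(x)$. Let $\{e_i\}$, $\{f^i\}$ be dual linear bases of $U$ and $A$, i.e. $\langle e_i,f^j\rangle=\delta_i^j$, and suppose that $\sigma'=\sum_i\langle S^{-2}(e_i),f^i\rangle\neq 0$. A biinvariant integral on $A$ is a linear map $\langle\cdot\rangle:A\to k$ with $\langle a_{(1)}\rangle a_{(2)}=\langle a\rangle 1=a_{(1)}\langle a_{(2)}\rangle$ for all $a\in A$. Then the antipode of $A$ is bijective, there is exactly one biinvariant integral on $A$ with $\langle 1\rangle=1$, and every biinvariant integral on $A$ satisfies $$\langle ba\rangle=\langle S^{-2}(a)\,b\rangle\qquad\text{for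 all } a,b\in A.$$ -/

import Mathlib

open scoped TensorProduct

/-- The inverse `S⁻¹` of the antipode, as the inverse in the ring of linear endomorphisms.
(The antipode of a finite-dimensional Hopf algebra over a field is invertible; for a
non-invertible endomorphism the value of `Ring.inverse` is `0`.) -/
noncomputable def antipodeInv (k H : Type*) [Field k] [Ring H] [HopfAlgebra k H] :
    Module.End k H :=
  Ring.inverse (HopfAlgebra.antipode k : Module.End k H)

/-- `p : U × A → k`, written `⟨x, a⟩`, is a duality of Hopf algebras: a nondegenerate bilinear
pairing that relates the algebra structure of each side to the coalgebra structure of the other: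
`⟨x y, a⟩ = ⟨x, a₁⟩ ⟨y, a₂⟩`, `⟨x, a b⟩ = ⟨x₁, a⟩ ⟨x₂, b⟩`, `⟨1, a⟩ = ε a`, `⟨x, 1⟩ = ε x`. -/
structure IsHopfDuality {k U A : Type*} [Field k] [Ring U] [HopfAlgebra k U]
    [Ring A] [HopfAlgebra k A] (p : U →ₗ[k] A →ₗ[k] k) : Prop where
  nondegenerate : p.Nondegenerate
  mul_left : ∀ (x y : U) (a : A),
    p (x * y) a = LinearMap.mul' k k (TensorProduct.map (p x) (p y) (Coalgebra.comul a))
  mul_right : ∀ (x : U) (a b : A),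
    p x (a * b) =
      LinearMap.mul' k k (TensorProduct.map (p.flip a) (p.flip b) (Coalgebra.comul x))
  one_left : ∀ a : A, p 1 a = Coalgebra.counit a
  one_right : ∀ x : U, p x 1 = Coalgebra.counit x

/-- The scalar `σ' = ∑ i, ⟨S⁻² (e i), f i⟩` for families `e` in `U` and `f` in `A`. -/
noncomputable def sigmaPrime {k U A ι : Type*} [Field k] [Ring U] [HopfAlgebra k U]
    [Ring A] [HopfAlgebra k A] [Fintype ι] (p : U →ₗ[k] A →ₗ[k] k) (e : ι → U) (f : ι → A) : k :=
  ∑ i, p (antipodeInv k U (antipodeInv k U (e i))) (f i)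

/-- A right (invariant) integral on `A`: `⟨a₁⟩ a₂ = ⟨a⟩ 1` for all `a`. -/
def IsRightIntegral {k A : Type*} [Field k] [Ring A] [HopfAlgebra k A] (I : A →ₗ[k] k) : Prop :=
  ∀ a : A, TensorProduct.lid k A (I.rTensor A (Coalgebra.comul a)) = I a • (1 : A)

/-- A left (invariant) integral on `A`: `a₁ ⟨a₂⟩ = ⟨a⟩ 1` for all `a`. -/
def IsLeftIntegral {k A : Type*} [Field k] [Ring A] [HopfAlgebra k A] (I : A →ₗ[k] k) : Prop :=
  ∀ a : A, TensorProduct.rid k A (I.lTensor A (Coalgebra.comul a)) = I a • (1 : A)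

/-- A biinvariant integral on `A`: both a right and a left integral. -/
def IsBiinvariantIntegral {k A : Type*} [Field k] [Ring A] [HopfAlgebra k A]
    (I : A →ₗ[k] k) : Prop :=
  IsRightIntegral I ∧ IsLeftIntegral I

/-!
The pairing turns `A` into a `U`-module algebra through the hit actions `x ⇀ a = a₁ ⟨x, a₂⟩` and
`a ↼ x = ⟨x, a₁⟩ a₂`, and `I` is a left integral iff `I (a ↼ x) = ε(x) I(a)`. Writing `R_a` for
right multiplication by `a` and `P_x` for `a ↦ a ↼ x`, one has
`R_{a ↼ x} S⁻² = ∑ P_{x₂} R_a S⁻² P_{S⁻¹(x₁)}`, where `∑ x₂ S⁻¹(x₁) = ε(x)`. By cyclicity of the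
trace, `a ↦ Tr (R_a S⁻²)` is therefore a left integral. Its value at `1` is `Tr S⁻² = σ' ≠ 0`,
which makes it biinvariant and, up to a scalar, the only biinvariant integral; and as
`R_{ba} = R_a R_b` and `S⁻² R_a = R_{S⁻²(a)} S⁻²`, cyclicity again gives the twisted commutation.

The same trace argument applied to left multiplications and `S²` shows that each
`a ↦ Tr (z ↦ y ⇀ (a S²(z)))` is a left integral. For dual bases `e`, `f` the values at `S(f i)` of
those with `y = e i` add up to `Tr (z ↦ ε(z) 1) = 1`, so a nonzero left integral `I` exists. It
satisfies `I (c S(x ⇀ a)) = I ((c ↼ x) S(a))`; for `a` in the kernel of `S` this makes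
`I (c S(x ⇀ a))` vanish for all `c` and `x`, whence `⟨x, a⟩ = ε(x ⇀ a) = 0` for all `x`.
-/

open Coalgebra HopfAlgebra WithConv
open LinearMap (trace)

section Coassociativity

variable {R H : Type*} [CommSemiring R] [Semiring H] [HopfAlgebra R H]

theorem sum_tmul_antipode_mul_eq (x : H) :
    ∑ i ∈ (ℛ R x).index, ∑ j ∈ (ℛ R ((ℛ R x).left i)).index,
      (ℛ R ((ℛ R x).left i)).left j ⊗ₜ[R]
        (antipode R ((ℛ R ((ℛ R x).left i)).right j) * (ℛ R x).right i) = x ⊗ₜ 1 := by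
  have coassoc := congr(((LinearMap.mul' R H ∘ₗ (antipode R).rTensor H).lTensor H)
    $(sum_tmul_tmul_eq (ℛ R x) (fun _ ↦ ℛ R _) fun _ ↦ ℛ R _))
  simp only [map_sum, LinearMap.lTensor_tmul, LinearMap.comp_apply, LinearMap.rTensor_tmul,
    LinearMap.mul'_apply] at coassoc
  have sum_smul : ∑ i ∈ (ℛ R x).index, counit (R := R) ((ℛ R x).right i) • (ℛ R x).left i = x := by
    simpa only [map_sum, TensorProduct.rid_tmul, one_smul] using
      congr(TensorProduct.rid R H $(sum_tmul_counit_eq (R := R) (ℛ R x)))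
  simp only [coassoc, ← TensorProduct.tmul_sum, sum_antipode_mul_eq_smul, TensorProduct.tmul_smul,
    TensorProduct.smul_tmul', ← TensorProduct.sum_tmul, sum_smul]

theorem sum_antipode_mul_tmul_eq (x : H) :
    ∑ i ∈ (ℛ R x).index, ∑ j ∈ (ℛ R ((ℛ R x).right i)).index,
      (antipode R ((ℛ R x).left i) * (ℛ R ((ℛ R x).right i)).left j) ⊗ₜ[R]
        (ℛ R ((ℛ R x).right i)).right j = 1 ⊗ₜ x := by
  have coassoc := congr(((LinearMap.mul' R H ∘ₗ (antipode R).rTensor H).rTensor H)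
    ((TensorProduct.assoc R H H H).symm
      $(sum_tmul_tmul_eq (ℛ R x) (fun _ ↦ ℛ R _) fun _ ↦ ℛ R _)))
  simp only [map_sum, TensorProduct.assoc_symm_tmul, LinearMap.comp_apply,
    LinearMap.rTensor_tmul, LinearMap.mul'_apply] at coassoc
  simp only [← coassoc, ← TensorProduct.sum_tmul, sum_antipode_mul_eq_smul,
    TensorProduct.smul_tmul]
  rw [← TensorProduct.tmul_sum, sum_counit_smul]

end Coassociativity

section AntipodeInv

variable {k H : Type*} [Field k] [Ring H] [HopfAlgebra k H]
  (hS : Function.Bijective (antipode k : H →ₗ[k] H))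
include hS

theorem antipodeInv_antipode (x : H) : antipodeInv k H (antipode k x) = x :=
  congr($(Ring.inverse_mul_cancel _ ((Module.End.isUnit_iff _).mpr hS)) x)

theorem antipode_antipodeInv (x : H) : antipode k (antipodeInv k H x) = x :=
  congr($(Ring.mul_inverse_cancel _ ((Module.End.isUnit_iff _).mpr hS)) x)

theorem antipodeInv_mul_antidistrib (x y : H) :
    antipodeInv k H (x * y) = antipodeInv k H y * antipodeInv k H x :=
  hS.injective <| by simp only [antipode_mul_antidistrib, antipode_antipodeInv hS]

theorem sum_mul_antipodeInv_eq_smul {ι : Type*} {x : H} (r : Repr k x ι) :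
    ∑ i ∈ r.index, r.right i * antipodeInv k H (r.left i) = counit (R := k) x • 1 :=
  hS.injective <| by
    simp only [map_sum, antipode_mul_antidistrib, antipode_antipodeInv hS,
      sum_mul_antipode_eq_smul, map_smul, antipode_one]

end AntipodeInv

section HitAction

variable {k V C : Type*} [Field k] [AddCommGroup V] [Module k V] [AddCommGroup C] [Module k C]
  [Coalgebra k C] {p : V →ₗ[k] C →ₗ[k] k}

/-- The left hit action `x ⇀ a = a₁ ⟨x, a₂⟩` of a space `V` paired with a coalgebra `C`; for a
Hopf duality it is dual to right multiplication by `x`. -/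
noncomputable def leftHit (p : V →ₗ[k] C →ₗ[k] k) : V →ₗ[k] Module.End k C where
  toFun x := (TensorProduct.rid k C).toLinearMap ∘ₗ (p x).lTensor C ∘ₗ comul
  map_add' x y := by ext; simp [LinearMap.lTensor_add]
  map_smul' c x := by ext; simp [LinearMap.lTensor_smul]

/-- The right hit action `a ↼ x = ⟨x, a₁⟩ a₂` of a space `V` paired with a coalgebra `C`; for a
Hopf duality it is dual to left multiplication by `x`. -/
noncomputable def rightHit (p : V →ₗ[k] C →ₗ[k] k) : V →ₗ[k] Module.End k C where
  toFun x := (TensorProduct.lid k C).toLinearMap ∘ₗ (p x).rTensor C ∘ₗ comul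
  map_add' x y := by ext; simp [LinearMap.rTensor_add]
  map_smul' c x := by ext; simp [LinearMap.rTensor_smul]

theorem leftHit_eq_sum {ι : Type*} {a : C} (r : Repr k a ι) (x : V) :
    leftHit p x a = ∑ i ∈ r.index, p x (r.right i) • r.left i := by
  simp [leftHit, ← r.eq]

theorem rightHit_eq_sum {ι : Type*} {a : C} (r : Repr k a ι) (x : V) :
    rightHit p x a = ∑ i ∈ r.index, p x (r.left i) • r.right i := by
  simp [rightHit, ← r.eq]

/-- The coproduct `Δ a = ∑ i, (e i ⇀ a) ⊗ f i`, for a basis `f` of `C` and the dual family `e`. -/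
noncomputable def dualRepr {ι : Type*} [Fintype ι] (f : Module.Basis ι k C) {e : ι → V}
    (he : ∀ i, p (e i) = f.coord i) (a : C) : Repr k a ι where
  index := Finset.univ
  left i := leftHit p (e i) a
  right := f
  eq := by
    have expand (b c : C) : ∑ i, (f.coord i c • b) ⊗ₜ[k] f i = b ⊗ₜ c := by
      simp only [TensorProduct.smul_tmul, ← TensorProduct.tmul_sum, f.coord_apply, f.sum_repr]
    simp only [leftHit_eq_sum (ℛ k a), he, TensorProduct.sum_tmul]
    rw [Finset.sum_comm]
    simp only [expand, (ℛ k a).eq]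

end HitAction

section Trace

variable {k V A : Type*} [Field k] [AddCommGroup V] [Module k V] [Ring A] [HopfAlgebra k A]
  {p : V →ₗ[k] A →ₗ[k] k}

/-- The functional `a ↦ Tr (z ↦ y ⇀ (a S²(z)))`, whose values at suitable `y` are the left
integrals from which the bijectivity of the antipode is deduced. -/
noncomputable def leftMulTrace (p : V →ₗ[k] A →ₗ[k] k) (y : V) : A →ₗ[k] k :=
  trace k A ∘ₗ LinearMap.mulLeft k (leftHit p y) ∘ₗ
    LinearMap.mulRight k (antipode k * antipode k) ∘ₗ LinearMap.mul k A

theorem leftMulTrace_apply (y : V) (a : A) : leftMulTrace p y a =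
    trace k A (leftHit p y * (LinearMap.mulLeft k a * (antipode k * antipode k))) :=
  rfl

theorem sum_leftMulTrace_antipode {ι : Type*} [Fintype ι] (f : Module.Basis ι k A) {e : ι → V}
    (he : ∀ i, p (e i) = f.coord i) : ∑ i, leftMulTrace p (e i) (antipode k (f i)) = 1 := by
  have := Module.Finite.of_basis f
  have := Module.Free.of_basis f
  have collapse : ∑ i, LinearMap.mulLeft k (antipode k (f i)) * (antipode k * antipode k) *
      leftHit p (e i) = (counit (R := k)).smulRight (1 : A) := by
    ext z
    simpa [dualRepr, antipode_mul_antidistrib] using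
      congr(antipode k $(sum_antipode_mul_eq_smul (dualRepr f he z)))
  calc ∑ i, leftMulTrace p (e i) (antipode k (f i))
      = trace k A ((counit (R := k)).smulRight (1 : A)) := by
        rw [← collapse, map_sum]
        exact Finset.sum_congr rfl fun i _ ↦ LinearMap.trace_mul_comm ..
    _ = 1 := by rw [LinearMap.trace_smulRight, Bialgebra.counit_one]

variable (k A) in
/-- The functional `a ↦ Tr (z ↦ S⁻²(z) a)`, the biinvariant integral with value `σ'` at `1`. -/
noncomputable def rightMulTrace : A →ₗ[k] k :=
  trace k A ∘ₗ LinearMap.mulRight k (antipodeInv k A * antipodeInv k A) ∘ₗ (LinearMap.mul k A).flip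

theorem rightMulTrace_apply (a : A) : rightMulTrace k A a =
    trace k A (LinearMap.mulRight k a * (antipodeInv k A * antipodeInv k A)) :=
  rfl

theorem rightMulTrace_mul (hA : Function.Bijective (antipode k : A →ₗ[k] A)) (a b : A) :
    rightMulTrace k A (b * a) =
      rightMulTrace k A (antipodeInv k A (antipodeInv k A a) * b) := by
  have sq_mul_mulRight : antipodeInv k A * antipodeInv k A * LinearMap.mulRight k a =
      LinearMap.mulRight k (antipodeInv k A (antipodeInv k A a)) *
        (antipodeInv k A * antipodeInv k A) := by
    ext z
    simp [antipodeInv_mul_antidistrib hA]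
  have mulRight_mul (c d : A) :
      LinearMap.mulRight k (c * d) = LinearMap.mulRight k d * LinearMap.mulRight k c := by
    ext z
    simp [mul_assoc]
  rw [rightMulTrace_apply, rightMulTrace_apply, mulRight_mul, mulRight_mul, mul_assoc,
    LinearMap.trace_mul_comm, mul_assoc, sq_mul_mulRight, mul_assoc]

end Trace

section HopfDuality

variable {k U A : Type*} [Field k] [Ring U] [HopfAlgebra k U] [Ring A] [HopfAlgebra k A]
  {p : U →ₗ[k] A →ₗ[k] k}

namespace IsHopfDuality

theorem flip (hp : IsHopfDuality p) : IsHopfDuality p.flip where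
  nondegenerate := LinearMap.flip_nondegenerate.mpr hp.nondegenerate
  mul_left a b x := hp.mul_right x a b
  mul_right a x y := hp.mul_left x y a
  one_left := hp.one_right
  one_right := hp.one_left

theorem ext_right (hp : IsHopfDuality p) {a b : A} (h : ∀ x, p x a = p x b) : a = b :=
  sub_eq_zero.mp <| hp.nondegenerate.2 _ fun x ↦ by rw [map_sub, h, sub_self]

theorem apply_mul (hp : IsHopfDuality p) {ι : Type*} {x : U} (r : Repr k x ι) (a b : A) :
    p x (a * b) = ∑ i ∈ r.index, p (r.left i) a * p (r.right i) b := by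
  simp [hp.mul_right, ← r.eq]

theorem mul_apply (hp : IsHopfDuality p) {ι : Type*} {a : A} (r : Repr k a ι) (x y : U) :
    p (x * y) a = ∑ i ∈ r.index, p x (r.left i) * p y (r.right i) :=
  hp.flip.apply_mul r x y

/-- Both sides are convolution inverses of `x ⊗ a ↦ ⟨x, a⟩` among the functionals on `U ⊗ A`. -/
theorem antipode_apply (hp : IsHopfDuality p) (x : U) (a : A) :
    p (antipode k x) a = p x (antipode k a) := by
  let φ (q : U →ₗ[k] A →ₗ[k] k) : WithConv (U ⊗[k] A →ₗ[k] k) := toConv (TensorProduct.lift q)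
  have left_inv : φ (p ∘ₗ antipode k) * φ p = 1 := by
    ext x a
    simp [((ℛ k x).tmul (ℛ k a)).convMul_apply, φ, Finset.sum_product, ← hp.mul_apply (ℛ k a),
      ← LinearMap.sum_apply, ← map_sum, sum_antipode_mul_eq_smul, hp.one_left,
      mul_comm (counit (R := k) x)]
  have right_inv : φ p * φ (p.compl₂ (antipode k)) = 1 := by
    ext x a
    simp [((ℛ k x).tmul (ℛ k a)).convMul_apply, φ, Finset.sum_product_right,
      ← hp.apply_mul (ℛ k x), ← map_sum, sum_mul_antipode_eq_smul, hp.one_right, mul_comm]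
  exact congr($(left_inv_eq_right_inv left_inv right_inv) (x ⊗ₜ a))

theorem exists_apply_eq_coord (hp : IsHopfDuality p) {ι : Type*} [Finite ι]
    (f : Module.Basis ι k A) : ∃ e : ι → U, ∀ i, p (e i) = f.coord i := by
  have := Module.Finite.of_basis f
  have := LinearMap.IsPerfPair.of_injective' (p := p)
    (LinearMap.ker_eq_bot.mp <| LinearMap.separatingLeft_iff_ker_eq_bot.mp hp.nondegenerate.1)
    (LinearMap.ker_eq_bot.mp <|
      LinearMap.separatingRight_iff_flip_ker_eq_bot.mp hp.nondegenerate.2)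
  choose e he using fun i ↦ p.toPerfPair.surjective (f.coord i)
  exact ⟨e, he⟩

variable (hp : IsHopfDuality p)
include hp

theorem apply_leftHit (x y : U) (a : A) : p y (leftHit p x a) = p (y * x) a := by
  simp [leftHit_eq_sum (ℛ k a), hp.mul_apply (ℛ k a), mul_comm]

theorem apply_rightHit (x y : U) (a : A) : p y (rightHit p x a) = p (x * y) a := by
  simp [rightHit_eq_sum (ℛ k a), hp.mul_apply (ℛ k a)]

theorem counit_leftHit (x : U) (a : A) : counit (R := k) (leftHit p x a) = p x a := by
  rw [← hp.one_left, hp.apply_leftHit, one_mul]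

theorem leftHit_one : leftHit p 1 = 1 :=
  LinearMap.ext fun a ↦ hp.ext_right fun y ↦ by simp [hp.apply_leftHit]

theorem rightHit_one : rightHit p 1 = 1 :=
  LinearMap.ext fun a ↦ hp.ext_right fun y ↦ by simp [hp.apply_rightHit]

theorem leftHit_mul (x y : U) : leftHit p (x * y) = leftHit p x * leftHit p y :=
  LinearMap.ext fun a ↦ hp.ext_right fun z ↦ by simp [hp.apply_leftHit, mul_assoc]

theorem rightHit_mul (x y : U) : rightHit p (x * y) = rightHit p y * rightHit p x :=
  LinearMap.ext fun a ↦ hp.ext_right fun z ↦ by simp [hp.apply_rightHit, mul_assoc]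

theorem commute_leftHit_rightHit (x y : U) : Commute (leftHit p x) (rightHit p y) :=
  LinearMap.ext fun a ↦ hp.ext_right fun z ↦ by
    simp [hp.apply_leftHit, hp.apply_rightHit, mul_assoc]

theorem leftHit_antipode (x : U) (a : A) :
    leftHit p x (antipode k a) = antipode k (rightHit p (antipode k x) a) :=
  hp.ext_right fun y ↦ by
    rw [hp.apply_leftHit, ← hp.antipode_apply, antipode_mul_antidistrib, ← hp.apply_rightHit,
      hp.antipode_apply]

theorem rightHit_antipode (x : U) (a : A) :
    rightHit p x (antipode k a) = antipode k (leftHit p (antipode k x) a) :=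
  hp.ext_right fun y ↦ by
    rw [hp.apply_rightHit, ← hp.antipode_apply, antipode_mul_antidistrib, ← hp.apply_leftHit,
      hp.antipode_apply]

theorem rightHit_apply_mul {ι : Type*} {x : U} (r : Repr k x ι) (a b : A) :
    rightHit p x (a * b) =
      ∑ i ∈ r.index, rightHit p (r.left i) a * rightHit p (r.right i) b :=
  hp.ext_right fun y ↦ by
    rw [hp.apply_rightHit, hp.mul_right, Bialgebra.comul_mul, ← r.eq, ← (ℛ k y).eq]
    simp [Finset.sum_mul_sum, hp.apply_mul (ℛ k y), hp.apply_rightHit]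

/-- Expanding `↼` on the product leaves `S(x₁₂) x₂` acting on `a`, which cancels. -/
theorem rightHit_mul_antipode (x : U) (c a : A) :
    rightHit p x c * antipode k a = ∑ i ∈ (ℛ k x).index,
      rightHit p ((ℛ k x).left i) (c * antipode k (leftHit p ((ℛ k x).right i) a)) := by
  let φ := LinearMap.mul' k A ∘ₗ TensorProduct.map ((rightHit p).flip c)
    (antipode k ∘ₗ (leftHit p).flip a)
  have cancel := congr(φ $(sum_tmul_antipode_mul_eq (R := k) x))
  simpa [φ, hp.rightHit_apply_mul (ℛ k _), hp.rightHit_antipode, hp.leftHit_mul,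
    hp.leftHit_one] using cancel.symm

/-- Expanding `↼` on the product leaves `S(x₁) x₂₁` acting on `b`, which cancels. -/
theorem mul_rightHit (x : U) (a b : A) :
    b * rightHit p x a = ∑ i ∈ (ℛ k x).index, rightHit p ((ℛ k x).right i)
      (rightHit p (antipode k ((ℛ k x).left i)) b * a) := by
  let φ := LinearMap.mul' k A ∘ₗ TensorProduct.map ((rightHit p).flip b) ((rightHit p).flip a)
  have cancel := congr(φ $(sum_antipode_mul_tmul_eq (R := k) x))
  simpa [φ, hp.rightHit_apply_mul (ℛ k _), hp.rightHit_mul, hp.rightHit_one] using cancel.symm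

theorem rightHit_antipodeInv_antipodeInv (hA : Function.Bijective (antipode k : A →ₗ[k] A))
    (hU : Function.Bijective (antipode k : U →ₗ[k] U)) (x : U) (a : A) :
    rightHit p x (antipodeInv k A (antipodeInv k A a)) =
      antipodeInv k A (antipodeInv k A (rightHit p (antipodeInv k U (antipodeInv k U x)) a)) := by
  obtain ⟨a, rfl⟩ := (hA.surjective.comp hA.surjective) a
  obtain ⟨x, rfl⟩ := (hU.surjective.comp hU.surjective) x
  simp only [Function.comp_apply, antipodeInv_antipode hA, antipodeInv_antipode hU,
    hp.rightHit_antipode, hp.leftHit_antipode]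

theorem antipodeInv_apply (hA : Function.Bijective (antipode k : A →ₗ[k] A))
    (hU : Function.Bijective (antipode k : U →ₗ[k] U)) (x : U) (a : A) :
    p (antipodeInv k U x) a = p x (antipodeInv k A a) := by
  rw [← antipode_antipodeInv hA a, ← hp.antipode_apply, antipode_antipodeInv hU,
    antipode_antipodeInv hA]

end IsHopfDuality

section Integral

theorem isLeftIntegral_iff (hp : IsHopfDuality p) {I : A →ₗ[k] k} :
    IsLeftIntegral I ↔ ∀ (x : U) (a : A), I (rightHit p x a) = counit (R := k) x * I a := by
  have pairing (x : U) (a : A) :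
      p x (TensorProduct.rid k A (I.lTensor A (comul a))) = I (rightHit p x a) := by
    simp [rightHit_eq_sum (ℛ k a), ← (ℛ k a).eq, mul_comm]
  have pairing_one (x : U) (a : A) : p x (I a • 1) = counit (R := k) x * I a := by
    rw [map_smul, hp.one_right, smul_eq_mul, mul_comm]
  exact ⟨fun h x a ↦ by rw [← pairing, h, pairing_one],
    fun h a ↦ hp.ext_right fun x ↦ by rw [pairing, h, pairing_one]⟩

theorem isRightIntegral_iff (hp : IsHopfDuality p) {I : A →ₗ[k] k} :
    IsRightIntegral I ↔ ∀ (x : U) (a : A), I (leftHit p x a) = counit (R := k) x * I a := by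
  have pairing (x : U) (a : A) :
      p x (TensorProduct.lid k A (I.rTensor A (comul a))) = I (leftHit p x a) := by
    simp [leftHit_eq_sum (ℛ k a), ← (ℛ k a).eq, mul_comm]
  have pairing_one (x : U) (a : A) : p x (I a • 1) = counit (R := k) x * I a := by
    rw [map_smul, hp.one_right, smul_eq_mul, mul_comm]
  exact ⟨fun h x a ↦ by rw [← pairing, h, pairing_one],
    fun h a ↦ hp.ext_right fun x ↦ by rw [pairing, h, pairing_one]⟩

namespace IsLeftIntegral

variable {L : A →ₗ[k] k} (hL : IsLeftIntegral L)
include hL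

theorem smul (c : k) : IsLeftIntegral (c • L) := fun a ↦ by
  simp [LinearMap.lTensor_smul, hL a, mul_smul]

theorem apply_mul_apply_one {R : A →ₗ[k] k} (hR : IsRightIntegral R) (a : A) :
    L a * R 1 = R a * L 1 := by
  have left := congr(R $(hL a))
  have right := congr(L $(hR a))
  simp only [← (ℛ k a).eq, map_sum, LinearMap.lTensor_tmul, LinearMap.rTensor_tmul,
    TensorProduct.rid_tmul, TensorProduct.lid_tmul, map_smul, smul_eq_mul] at left right
  rw [← left, ← right]
  exact Finset.sum_congr rfl fun _ _ ↦ mul_comm _ _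

theorem comp_antipode (hp : IsHopfDuality p)
    (hU : Function.Surjective (antipode k : U →ₗ[k] U)) :
    IsRightIntegral (L ∘ₗ antipode k) := by
  refine (isRightIntegral_iff hp).mpr fun x a ↦ ?_
  obtain ⟨y, rfl⟩ := hU x
  rw [LinearMap.comp_apply, ← hp.rightHit_antipode, (isLeftIntegral_iff hp).mp hL,
    counit_antipode, LinearMap.comp_apply]

theorem isBiinvariantIntegral (hp : IsHopfDuality p)
    (hU : Function.Surjective (antipode k : U →ₗ[k] U)) (h : L 1 ≠ 0) :
    IsBiinvariantIntegral L := by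
  have hR := hL.comp_antipode hp hU
  have eq_comp_antipode : L = L ∘ₗ antipode k := LinearMap.ext fun a ↦
    mul_right_cancel₀ h <| by simpa using hL.apply_mul_apply_one hR a
  exact ⟨eq_comp_antipode ▸ hR, hL⟩

theorem apply_mul_antipode_leftHit (hp : IsHopfDuality p) (x : U) (c a : A) :
    L (c * antipode k (leftHit p x a)) = L (rightHit p x c * antipode k a) := by
  simp only [hp.rightHit_mul_antipode, map_sum, (isLeftIntegral_iff hp).mp hL]
  conv_lhs => rw [← sum_counit_smul (ℛ k x)]
  simp [Finset.mul_sum]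

theorem counit_eq_zero (hp : IsHopfDuality p) [Module.Finite k A] (hL₀ : L ≠ 0) {a : A}
    (ha : ∀ c, L (c * antipode k a) = 0) : counit (R := k) a = 0 := by
  let f := Module.finBasis k A
  obtain ⟨e, he⟩ := hp.exists_apply_eq_coord f
  obtain ⟨c, hc⟩ := DFunLike.ne_iff.mp hL₀
  have sum_mul : ∑ i, antipode k (antipode k (f i)) * antipode k (leftHit p (e i) a) =
      counit (R := k) a • 1 := by
    simpa [dualRepr, antipode_mul_antidistrib] using
      congr(antipode k $(sum_mul_antipode_eq_smul (dualRepr f he a)))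
  have : L (c * (counit (R := k) a • 1)) = 0 := by
    simp [← sum_mul, Finset.mul_sum, ← mul_assoc, hL.apply_mul_antipode_leftHit hp, ha]
  rw [mul_smul_comm, mul_one, map_smul, smul_eq_mul] at this
  exact (mul_eq_zero.mp this).resolve_right hc

end IsLeftIntegral

theorem IsBiinvariantIntegral.eq_smul {I J : A →ₗ[k] k} (hI : IsBiinvariantIntegral I)
    (hJ : IsBiinvariantIntegral J) (hJ₁ : J 1 = 1) : I = I 1 • J :=
  LinearMap.ext fun a ↦ by simpa [hJ₁, mul_comm] using hI.2.apply_mul_apply_one hJ.1 a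

end Integral

section TraceIntegral

theorem trace_sum_rightHit_mul_mul (hp : IsHopfDuality p) {ι : Type*} {s : Finset ι}
    {u v : ι → U} {c : k} (h : ∑ i ∈ s, u i * v i = c • 1) (F : Module.End k A) :
    trace k A (∑ i ∈ s, rightHit p (u i) * F * rightHit p (v i)) = c * trace k A F := by
  calc trace k A (∑ i ∈ s, rightHit p (u i) * F * rightHit p (v i))
      = trace k A (rightHit p (∑ i ∈ s, u i * v i) * F) := by
        simp only [map_sum, hp.rightHit_mul, Finset.sum_mul, mul_assoc]
        exact Finset.sum_congr rfl fun i _ ↦ by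
          rw [← mul_assoc, LinearMap.trace_mul_comm]
    _ = c * trace k A F := by simp [h, hp.rightHit_one]

theorem isLeftIntegral_leftMulTrace (hp : IsHopfDuality p) (y : U) :
    IsLeftIntegral (leftMulTrace p y) := by
  refine (isLeftIntegral_iff hp).mpr fun x a ↦ ?_
  have expand : LinearMap.mulLeft k (rightHit p x a) * (antipode k * antipode k) =
      ∑ i ∈ (ℛ k x).index, rightHit p ((ℛ k x).left i) *
        (LinearMap.mulLeft k a * (antipode k * antipode k)) *
          rightHit p (antipode k ((ℛ k x).right i)) := by
    ext z
    simp [hp.rightHit_mul_antipode, hp.leftHit_antipode]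
  simp only [leftMulTrace_apply, expand, Finset.mul_sum]
  simp only [← mul_assoc, (hp.commute_leftHit_rightHit _ _).eq]
  rw [← trace_sum_rightHit_mul_mul hp (sum_mul_antipode_eq_smul (ℛ k x))]
  simp only [mul_assoc]

theorem isLeftIntegral_rightMulTrace (hp : IsHopfDuality p)
    (hA : Function.Bijective (antipode k : A →ₗ[k] A))
    (hU : Function.Bijective (antipode k : U →ₗ[k] U)) :
    IsLeftIntegral (rightMulTrace k A) := by
  refine (isLeftIntegral_iff hp).mpr fun x a ↦ ?_
  have expand : LinearMap.mulRight k (rightHit p x a) * (antipodeInv k A * antipodeInv k A) =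
      ∑ i ∈ (ℛ k x).index, rightHit p ((ℛ k x).right i) *
        (LinearMap.mulRight k a * (antipodeInv k A * antipodeInv k A)) *
          rightHit p (antipodeInv k U ((ℛ k x).left i)) := by
    ext z
    simp [hp.mul_rightHit, hp.rightHit_antipodeInv_antipodeInv hA hU, antipodeInv_antipode hU]
  rw [rightMulTrace_apply, expand,
    trace_sum_rightHit_mul_mul hp (sum_mul_antipodeInv_eq_smul hU (ℛ k x)), rightMulTrace_apply]

theorem sigmaPrime_eq_rightMulTrace_one (hp : IsHopfDuality p)
    (hA : Function.Bijective (antipode k : A →ₗ[k] A))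
    (hU : Function.Bijective (antipode k : U →ₗ[k] U)) {ι : Type*} [Fintype ι]
    (f : Module.Basis ι k A) {e : ι → U} (he : ∀ i, p (e i) = f.coord i) :
    sigmaPrime p e f = rightMulTrace k A 1 := by
  classical
  simp [rightMulTrace_apply, LinearMap.trace_eq_matrix_trace k f, Matrix.trace,
    LinearMap.toMatrix_apply, sigmaPrime, hp.antipodeInv_apply hA hU, he]

end TraceIntegral

section AntipodeBijective

variable [Module.Finite k A]

theorem exists_isLeftIntegral_ne_zero (hp : IsHopfDuality p) :
    ∃ L : A →ₗ[k] k, IsLeftIntegral L ∧ L ≠ 0 := by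
  let f := Module.finBasis k A
  obtain ⟨e, he⟩ := hp.exists_apply_eq_coord f
  obtain ⟨i, -, hi⟩ := Finset.exists_ne_zero_of_sum_ne_zero
    (sum_leftMulTrace_antipode f he ▸ one_ne_zero)
  exact ⟨leftMulTrace p (e i), isLeftIntegral_leftMulTrace hp _, fun h ↦ hi (by simp [h])⟩

theorem antipode_bijective (hp : IsHopfDuality p) :
    Function.Bijective (antipode k : A →ₗ[k] A) := by
  obtain ⟨L, hL, hL₀⟩ := exists_isLeftIntegral_ne_zero hp
  have injective : Function.Injective (antipode k : A →ₗ[k] A) := by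
    refine (injective_iff_map_eq_zero _).mpr fun a ha ↦ hp.ext_right fun x ↦ ?_
    rw [← hp.counit_leftHit, map_zero]
    exact hL.counit_eq_zero hp hL₀ fun c ↦ by
      rw [hL.apply_mul_antipode_leftHit hp, ha, mul_zero, map_zero]
  exact ⟨injective, LinearMap.injective_iff_surjective.mp injective⟩

end AntipodeBijective

end HopfDuality

theorem proposition1 {k U A ι : Type*} [Field k] [Ring U] [HopfAlgebra k U]
    [Ring A] [HopfAlgebra k A] [Fintype ι] [DecidableEq ι]
    (p : U →ₗ[k] A →ₗ[k] k) (hp : IsHopfDuality p)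
    (e : Module.Basis ι k U) (f : Module.Basis ι k A)
    (hef : ∀ i j, p (e i) (f j) = if i = j then 1 else 0)
    (hσ : sigmaPrime p e f ≠ 0) :
    Function.Bijective (HopfAlgebra.antipode k : A →ₗ[k] A) ∧
    (∃! I : A →ₗ[k] k, IsBiinvariantIntegral I ∧ I 1 = 1) ∧
    ∀ I : A →ₗ[k] k, IsBiinvariantIntegral I →
      ∀ a b : A, I (b * a) = I (antipodeInv k A (antipodeInv k A a) * b) := by
  have := Module.Finite.of_basis e
  have := Module.Finite.of_basis f
  have hA := antipode_bijective hp
  have hU := antipode_bijective hp.flip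
  have coord (i : ι) : p (e i) = f.coord i := f.ext fun j ↦ by
    simp [hef, Finsupp.single_apply, eq_comm]
  have ne_zero : rightMulTrace k A 1 ≠ 0 := sigmaPrime_eq_rightMulTrace_one hp hA hU f coord ▸ hσ
  let J : A →ₗ[k] k := (rightMulTrace k A 1)⁻¹ • rightMulTrace k A
  have hJ₁ : J 1 = 1 := by simp [J, ne_zero]
  have hJ : IsBiinvariantIntegral J :=
    ((isLeftIntegral_rightMulTrace hp hA hU).smul _).isBiinvariantIntegral hp hU.surjective <| by
      simp [ne_zero]
  refine ⟨hA, ⟨J, ⟨hJ, hJ₁⟩, fun I ⟨hI, hI₁⟩ ↦ ?_⟩, fun I hI a b ↦ ?_⟩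
  · rw [hI.eq_smul hJ hJ₁, hI₁, one_smul]
  · rw [hI.eq_smul hJ hJ₁]
    simp [J, rightMulTrace_mul hA a]
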